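/- **Theorem (Explicit form of the kernel norm).** Let $\mu$ be a probability measure on $\mathbb{R}^2$ with finite second moments, the law of a pair of real random variables $(\mathcal{W},\mathcal{B})$ (the initial input weight and bias of a hidden ReLU unit), and assume that $\mathbb{P}(\mathcal{W}=0)=0$ and that the breakpoint $\mathcal{C}=-\mathcal{B}/\mathcal{W}$ has a Lebesgue density $p_{\mathcal{C}}$. Put $$\tilde\Theta(x,y)=\int_{\mathbb{R}^2}[Wx+b]_+\,[Wy+b]_+\,\mathrm{d}\mu(W,b),\qquad \zeta(x)=p_{\mathcal{C}}(x)\,\mathbb{E}(\mathcal{W}^2\mid\mathcal{C}=x).$$ Let $x_1,\dots,x_M\in\mathbb{R}$ with $M\ge 1$, and let $S=\operatorname{supp}(\zeta)\cap[\min_i x_i,\max_i x_i]$, where $\operatorname{supp}(\zeta)$ is the support of the measure $\zeta(x)\,\mathrm{d}x$. Let $\mathcal{H}_{\tilde\Theta}(S)$ be the reproducing kernel Hilbert space of functions $S\to\mathbb{R}$ with kernel $\tilde\Theta$, and let $\langle\cdot,\cdot\rangle_{\tilde\Theta}$ and $\|\cdot\|_{\tilde\Theta}$ be its inner product and norm.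 Let $W\subseteq\mathcal{H}_{\tilde\Theta}(S)$ be the orthogonal complement of the set of those elements of $\mathcal{H}_{\tilde\Theta}(S)$ that have the form $x\mapsto ux+v$ on $S$ with $u,v\in\mathbb{R}$; if the functions $1$ and $x$ belong to $\mathcal{H}_{\tilde\Theta}(S)$, this is $W=\{h\in\mathcal{H}_{\tilde\Theta}(S):\langle h,x\rangle_{\tilde\Theta}=0,\ \langle h,1\rangle_{\tilde\Theta}=0\}$. Then every $h\in W$ is continuously differentiable on $S$ (derivatives being taken within $S$, at points that are not isolated in $S$). Its derivative $h'$ has a derivative $h''(x)$ for almost every $x\in S$; $h''$ is integrable on $S$, and $h'(b)-h'(a)=\int_{S\cap[a,b]}h''(x)\,\mathrm{d}x$ for all non-isolated points $a\le b$ of $S$. Moreover $(h'')^2/\zeta$ is integrable on $S$ (with the convention $0/0=0$), and $$\|h\|_{\tilde\Theta}^2=\int_S\frac{(h''(x))^2}{\zeta(x)}\,\mathrm{d}x .$$ -/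

import Mathlib

open MeasureTheory ProbabilityTheory Set Filter
open scoped Topology ENNReal InnerProductSpace

noncomputable section

/-- The output at the input `x` of a hidden ReLU unit `p = (W, b)`: `[W x + b]₊`. -/
def reluUnit (x : ℝ) (p : ℝ × ℝ) : ℝ := max (p.1 * x + p.2) 0

/-- The breakpoint `c = -b / W` of the ReLU unit `p = (W, b)`. -/
def breakpoint (p : ℝ × ℝ) : ℝ := -p.2 / p.1

/-- The infinite-width neural tangent kernel of training only the output layer, where `μ` is the
law of the initial weight-bias pair `(𝓦, 𝓑)`:
`Θ(x, y) = ∫ [W x + b]₊ [W y + b]₊ dμ(W, b)`. -/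
def outputNTK (μ : Measure (ℝ × ℝ)) (x y : ℝ) : ℝ :=
  ∫ p, reluUnit x p * reluUnit y p ∂μ

/-- `ζ(x) = p_𝓒(x) 𝔼(𝓦² | 𝓒 = x)`, with `p_𝓒` the Lebesgue density of the breakpoint
`𝓒 = -𝓑 / 𝓦` and with the conditional expectation taken as the integral of `w²` against the
regular conditional distribution of `𝓦` given `𝓒 = x`. -/
def zeta (μ : Measure (ℝ × ℝ)) [IsFiniteMeasure μ] (x : ℝ) : ℝ :=
  (pdf breakpoint μ volume x).toReal * ∫ w, w ^ 2 ∂(condDistrib Prod.fst breakpoint μ x)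

/-- `S = supp(ζ) ∩ [minᵢ xᵢ, maxᵢ xᵢ]`. As `ζ` is built from a density, it is determined only up
to Lebesgue-null sets; its support is the support of the measure `ζ(x) dx`. -/
def inputDomain (μ : Measure (ℝ × ℝ)) [IsFiniteMeasure μ] {M : ℕ} (x : Fin M → ℝ) : Set ℝ :=
  (volume.withDensity fun t => ENNReal.ofReal (zeta μ t)).support ∩ Icc (⨅ i, x i) (⨆ i, x i)

/-- The kernel `Θ` on `S × S` in the form of Mathlib's operator-valued kernels, the real number
`Θ(x, y)` acting on `ℝ` by multiplication. -/
def outputNTKMatrix (μ : Measure (ℝ × ℝ)) (S : Set ℝ) : Matrix S S (ℝ →L[ℝ] ℝ) :=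
  Matrix.of fun x y => outputNTK μ x y • ContinuousLinearMap.id ℝ ℝ

theorem memLp_reluUnit (μ : Measure (ℝ × ℝ)) [IsFiniteMeasure μ]
    (hμ : MemLp (fun p : ℝ × ℝ => p) 2 μ) (x : ℝ) : MemLp (reluUnit x) 2 μ := by
  have h1 : MemLp (fun p : ℝ × ℝ => p.1) 2 μ := hμ.fst
  have h2 : MemLp (fun p : ℝ × ℝ => p.2) 2 μ := hμ.snd
  have h3 : MemLp (fun p : ℝ × ℝ => p.1 * x + p.2) 2 μ := (h1.mul_const x).add h2
  exact h3.pos_part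

theorem posSemidef_outputNTKMatrix (μ : Measure (ℝ × ℝ)) [IsFiniteMeasure μ]
    (hμ : MemLp (fun p : ℝ × ℝ => p) 2 μ) (S : Set ℝ) :
    (outputNTKMatrix μ S).PosSemidef := by
  have htfae := (RKHS.posSemidef_tfae (K := outputNTKMatrix μ S)).out 0 2
  refine htfae.mpr ⟨?_, fun v => ?_⟩
  · have hid : star (ContinuousLinearMap.id ℝ ℝ) = ContinuousLinearMap.id ℝ ℝ := star_one _
    ext x y
    simp [outputNTKMatrix, outputNTK, mul_comm, hid]
  · have hint : ∀ x y : ℝ, Integrable (fun p => reluUnit x p * reluUnit y p) μ := fun x y =>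
      (memLp_reluUnit μ hμ x).integrable_mul (memLp_reluUnit μ hμ y)
    have key : (v.sum fun x w => v.sum fun x' w' =>
        ⟪outputNTKMatrix μ S x' x w, w'⟫_ℝ)
        = ∫ p, (v.sum fun x w => w * reluUnit x p) ^ 2 ∂μ := by
      simp only [Finsupp.sum, sq, Finset.sum_mul_sum]
      rw [integral_finsetSum _ fun i _ => integrable_finsetSum _ fun j _ => by
        simpa [mul_mul_mul_comm] using (hint i j).const_mul (v i * v j)]
      refine Finset.sum_congr rfl fun i _ => ?_
      rw [integral_finsetSum _ fun j _ => by
        simpa [mul_mul_mul_comm] using (hint i j).const_mul (v i * v j)]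
      refine Finset.sum_congr rfl fun j _ => ?_
      simp only [mul_mul_mul_comm _ (reluUnit _ _), integral_const_mul]
      simp [outputNTKMatrix, outputNTK, mul_comm, mul_left_comm]
    rw [key]
    exact integral_nonneg fun p => sq_nonneg _

instance fact_posSemidef_outputNTKMatrix (μ : Measure (ℝ × ℝ)) [IsFiniteMeasure μ]
    [hμ : Fact (MemLp (fun p : ℝ × ℝ => p) 2 μ)] (S : Set ℝ) :
    Fact (outputNTKMatrix μ S).PosSemidef :=
  ⟨posSemidef_outputNTKMatrix μ hμ.out S⟩

section KernelSpace

variable (μ : Measure (ℝ × ℝ)) [IsFiniteMeasure μ] [Fact (MemLp (fun p : ℝ × ℝ => p) 2 μ)]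
  (S : Set ℝ)

/-- The reproducing kernel Hilbert space `H_Θ(S)` of functions `S → ℝ` generated by `Θ`. -/
def KernelSpace : Type := RKHS.OfKernel (outputNTKMatrix μ S)

instance : NormedAddCommGroup (KernelSpace μ S) :=
  inferInstanceAs (NormedAddCommGroup (RKHS.OfKernel (outputNTKMatrix μ S)))

instance : InnerProductSpace ℝ (KernelSpace μ S) :=
  inferInstanceAs (InnerProductSpace ℝ (RKHS.OfKernel (outputNTKMatrix μ S)))

instance : CompleteSpace (KernelSpace μ S) :=
  inferInstanceAs (CompleteSpace (RKHS.OfKernel (outputNTKMatrix μ S)))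

instance : RKHS ℝ (KernelSpace μ S) S ℝ :=
  inferInstanceAs (RKHS ℝ (RKHS.OfKernel (outputNTKMatrix μ S)) S ℝ)

theorem kernel_kernelSpace (x y : S) :
    RKHS.kernel (KernelSpace μ S) x y = outputNTK μ x y • ContinuousLinearMap.id ℝ ℝ :=
  congrFun (congrFun (RKHS.OfKernel.kernel_ofKernel (K := outputNTKMatrix μ S)) x) y

/-- The elements of `H_Θ(S)` which are functions of the form `x ↦ u x + v` on `S`. -/
def affineElements : Submodule ℝ (KernelSpace μ S) where
  carrier := {g | ∃ u v : ℝ, ∀ x : S, g x = u * x + v}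
  zero_mem' := ⟨0, 0, fun x => by simp⟩
  add_mem' := by
    rintro f g ⟨u, v, hf⟩ ⟨u', v', hg⟩
    exact ⟨u + u', v + v', fun x => by simp [hf x, hg x]; ring⟩
  smul_mem' := by
    rintro c f ⟨u, v, hf⟩
    exact ⟨c * u, c * v, fun x => by simp [hf x]; ring⟩

/-- The space `W`: the orthogonal complement in `H_Θ(S)` of the constant and linear functions. -/
def spaceW : Submodule ℝ (KernelSpace μ S) := (affineElements μ S)ᗮ

variable {μ S} in
/-- If the functions `1` and `x` belong to `H_Θ(S)`, then `W = {h | ⟨h, x⟩ = 0, ⟨h, 1⟩ = 0}`. -/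
theorem mem_spaceW_iff {e₀ e₁ : KernelSpace μ S} (h₀ : ∀ x : S, e₀ x = 1)
    (h₁ : ∀ x : S, e₁ x = x) (h : KernelSpace μ S) :
    h ∈ spaceW μ S ↔ ⟪h, e₁⟫_ℝ = 0 ∧ ⟪h, e₀⟫_ℝ = 0 := by
  rw [spaceW, Submodule.mem_orthogonal']
  constructor
  · intro H
    exact ⟨H _ ⟨1, 0, fun x => by simp [h₁]⟩, H _ ⟨0, 1, fun x => by simp [h₀]⟩⟩
  · rintro ⟨H1, H0⟩ g ⟨u, v, hg⟩
    have : g = u • e₁ + v • e₀ := RKHS.ext fun x => by simp [hg, h₀, h₁]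
    rw [this, inner_add_right, inner_smul_right, inner_smul_right, H1, H0]
    simp

end KernelSpace

/-- The derivative `h'` of a function `h` on a set `S` of reals, taken within `S`. (The extension
of `h` by zero only serves to apply `derivWithin`: at points of `S` the result depends only on the
values of `h` on `S`.) -/
def derivOn {S : Set ℝ} (h : S → ℝ) : ℝ → ℝ :=
  derivWithin (Function.extend Subtype.val h 0) S

/-- The second derivative `h''` of a function `h` on a set `S` of reals, taken within `S`. -/
def secondDerivOn {S : Set ℝ} (h : S → ℝ) : ℝ → ℝ :=
  derivWithin (derivOn h) S

/-- `h` has a second derivative on `S` in the sense of Sobolev functions: `h` is continuously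
differentiable on `S`, and `h'` has almost everywhere a derivative `h''`, which is integrable and
whose integral is `h'` (at isolated points of `S` there is no derivative to speak of). -/
structure HasIntegrableSecondDerivOn {S : Set ℝ} (h : S → ℝ) : Prop where
  differentiableOn : DifferentiableOn ℝ (Function.extend Subtype.val h 0) S
  continuousOn_deriv : ContinuousOn (derivOn h) S
  ae_differentiable : ∀ᵐ x ∂(volume.restrict S), DifferentiableWithinAt ℝ (derivOn h) S x
  integrableOn : IntegrableOn (secondDerivOn h) S
  integral_eq : ∀ a ∈ S, ∀ b ∈ S, AccPt a (𝓟 S) → AccPt b (𝓟 S) → a ≤ b →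
    derivOn h b - derivOn h a = ∫ x in S ∩ Icc a b, secondDerivOn h x

end

/-!
The kernel space `H_Θ(S)` embeds isometrically into `L²(μ)` by `k_y ↦ φ_y`, where `φ_y = reluUnit y`
is the feature `(W, b) ↦ [W y + b]₊` (`exists_isometry_kernelSpace`).

Let `ν = ζ(t) dt`. Disintegration along the breakpoint `C` shows that `ν` is the image of `W² dμ`
under `C` (`map_breakpoint_withDensity`), so `f ↦ 1_I(C) |W| f(C)` is an isometry `J` of `L²(ν|_I)`
into `L²(μ)`, for `I = [minᵢ xᵢ, maxᵢ xᵢ]`. Since `W y + b = W (y - C)`, for every `y ∈ I`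
the feature splits as `φ_y = J (c ↦ [y - c]₊) + y Q₁ + Q₀` with `Q₁, Q₀ ∈ L²(μ)` not depending on
`y` (`exists_toLp_reluUnit_eq`).

Consequently a vector `g` orthogonal to the closed subspace `range J` represents the affine function
`y ↦ ⟪g, φ_y⟫ = y ⟪g, Q₁⟫ + ⟪g, Q₀⟫`. An element `h` of `spaceW`, being orthogonal to the affine
elements, is therefore mapped into `(range J)ᗮᗮ = range J` (`map_mem_range_of_mem_spaceW`), say to
`J f`. Then `‖h‖² = ∫_S f² ζ` and `h(y) = ∫_S [y - c]₊ f(c) ζ(c) dc + u y + v`. Differentiating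
twice gives `h'' = f ζ` almost everywhere on `S`
(`hasIntegrableSecondDerivOn_of_integral_max_sub_mul`), and `(h'')² / ζ = f² ζ`. Since `ν` has no
atoms, only the two endpoints of `I` can be isolated points of `S`
(`finite_not_accPt_support_inter_Icc`), so that isolated points do not affect `h'` near the
other points.
-/

/-! ### Feature maps of reproducing kernel Hilbert spaces -/

/-- A feature map `φ` of the kernel of `H`, that is `⟪φ x, φ y⟫ = k(x, y)`, extends to an isometric
embedding of `H` which sends the kernel function at `x` to `φ x`: on linear combinations of kernel
functions the norms agree, and these combinations are dense. -/
theorem exists_isometry_of_kernel_eq_inner {X H E : Type*}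
    [NormedAddCommGroup H] [InnerProductSpace ℝ H] [CompleteSpace H] [RKHS ℝ H X ℝ]
    [NormedAddCommGroup E] [InnerProductSpace ℝ E] [CompleteSpace E] (φ : X → E)
    (hφ : ∀ x y, ⟪φ x, φ y⟫_ℝ = RKHS.kernel H x y 1) :
    ∃ U : H →ₗᵢ[ℝ] E, ∀ x, U (RKHS.kerFun H x 1) = φ x := by
  set k : X → H := fun x => RKHS.kerFun H x 1 with hk
  set e : (X →₀ ℝ) →ₗ[ℝ] H := Finsupp.linearCombination ℝ k with he
  set f : (X →₀ ℝ) →ₗ[ℝ] E := Finsupp.linearCombination ℝ φ with hf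
  have hkk : ∀ x y, ⟪k x, k y⟫_ℝ = ⟪φ x, φ y⟫_ℝ := fun x y => by
    rw [hφ, RKHS.kerFun_inner, RKHS.kerFun_apply]
    simp
  have hnorm : ∀ c, ‖f c‖ = ‖e c‖ := fun c => by
    rw [← sq_eq_sq₀ (norm_nonneg _) (norm_nonneg _), ← real_inner_self_eq_norm_sq,
      ← real_inner_self_eq_norm_sq]
    simp only [he, hf, Finsupp.linearCombination_apply, Finsupp.sum, sum_inner, inner_sum,
      inner_smul_left, inner_smul_right, hkk]
  have hdense : DenseRange e := by
    rw [DenseRange, ← LinearMap.coe_range, Finsupp.range_linearCombination,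
      Submodule.dense_iff_topologicalClosure_eq_top, eq_top_iff, ← RKHS.kerFun_dense (𝕜 := ℝ) H]
    refine Submodule.topologicalClosure_mono (Submodule.span_le.2 ?_)
    rintro _ ⟨x, v, rfl⟩
    have : RKHS.kerFun H x v = v • k x := by
      rw [hk, ← map_smul, smul_eq_mul, mul_one]
    rw [this]
    exact Submodule.smul_mem _ _ (Submodule.subset_span ⟨x, rfl⟩)
  have hle : ∀ c, ‖f c‖ ≤ 1 * ‖e c‖ := fun c => by rw [one_mul, hnorm]
  set L : H →L[ℝ] E := f.extendOfNorm e with hL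
  have hLe : ∀ c, L (e c) = f c := LinearMap.extendOfNorm_eq hdense ⟨1, hle⟩
  have hLk : ∀ x, L (k x) = φ x := fun x => by
    simpa [he, hf] using hLe (Finsupp.single x 1)
  have hLnorm : ∀ h, ‖L h‖ = ‖h‖ := fun h => by
    refine hdense.induction_on (p := fun h => ‖L h‖ = ‖h‖) h
      (isClosed_eq (by fun_prop) (by fun_prop)) fun c => ?_
    rw [hLe, hnorm]
  exact ⟨⟨L.toLinearMap, hLnorm⟩, hLk⟩

/-! ### The breakpoint distribution weighted by `W²` -/

theorem measurable_breakpoint : Measurable breakpoint := by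
  unfold breakpoint; fun_prop

theorem integrable_fst_sq {μ : Measure (ℝ × ℝ)} (hμ : MemLp (fun p : ℝ × ℝ => p) 2 μ) :
    Integrable (fun p : ℝ × ℝ => p.1 ^ 2) μ := hμ.fst.integrable_sq

theorem zeta_nonneg (μ : Measure (ℝ × ℝ)) [IsFiniteMeasure μ] (t : ℝ) : 0 ≤ zeta μ t :=
  mul_nonneg ENNReal.toReal_nonneg (integral_nonneg fun w => sq_nonneg w)

theorem measurable_zeta (μ : Measure (ℝ × ℝ)) [IsFiniteMeasure μ] : Measurable (zeta μ) := by
  refine (measurable_pdf _ _ _).ennreal_toReal.mul ?_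
  have : StronglyMeasurable (fun q : ℝ × ℝ => q.2 ^ 2) := by
    apply Measurable.stronglyMeasurable; fun_prop
  exact this.integral_condDistrib.measurable

/-- The image of `W² dμ` under the breakpoint is `ζ(t) dt`. This is where the definition of `ζ` by
the regular conditional distribution of `𝓦` given `𝓒` enters. -/
theorem map_breakpoint_withDensity (μ : Measure (ℝ × ℝ)) [IsFiniteMeasure μ]
    (hμ : MemLp (fun p : ℝ × ℝ => p) 2 μ) (hC : HasPDF breakpoint μ volume) :
    (μ.withDensity fun p => ENNReal.ofReal (p.1 ^ 2)).map breakpoint =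
      volume.withDensity fun t => ENNReal.ofReal (zeta μ t) := by
  have hbm := measurable_breakpoint
  set κ := condDistrib Prod.fst breakpoint μ with hκ
  have hjoint : (μ.map breakpoint) ⊗ₘ κ = μ.map fun p => (breakpoint p, p.1) :=
    compProd_map_condDistrib (by fun_prop)
  have hmap : μ.map breakpoint = volume.withDensity (pdf breakpoint μ volume) :=
    map_eq_withDensity_pdf _ _ _
  have hpdf := measurable_pdf breakpoint μ volume
  have hint : ∀ᵐ c ∂μ.map breakpoint, Integrable (fun w => w ^ 2) (κ c) := by
    refine Integrable.condDistrib_ae_map (f := fun q : ℝ × ℝ => q.2 ^ 2) (by fun_prop) ?_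
    rw [integrable_map_measure (by fun_prop) (by fun_prop)]
    exact integrable_fst_sq hμ
  -- Outside a null set, neither the `toReal` of the density nor the Bochner integral in `zeta`
  -- takes a junk value, unless the density vanishes.
  have hz : ∀ᵐ c, pdf breakpoint μ volume c * ∫⁻ w, ENNReal.ofReal (w ^ 2) ∂κ c =
      ENNReal.ofReal (zeta μ c) := by
    rw [hmap, ae_withDensity_iff hpdf] at hint
    filter_upwards [hint, (pdf.ae_lt_top : ∀ᵐ c, pdf breakpoint μ volume c < ∞)] with c hc htop
    by_cases h0 : pdf breakpoint μ volume c = 0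
    · simp [zeta, h0]
    · rw [zeta, ENNReal.ofReal_mul ENNReal.toReal_nonneg, ENNReal.ofReal_toReal htop.ne,
        ofReal_integral_eq_lintegral_ofReal (hc h0) (ae_of_all _ fun w => sq_nonneg w)]
  have hsq : Measurable fun q : ℝ × ℝ => ENNReal.ofReal (q.2 ^ 2) := by fun_prop
  ext A hA
  rw [Measure.map_apply hbm hA, withDensity_apply _ (hbm hA), withDensity_apply _ hA,
    ← setLIntegral_congr_fun_ae hA (hz.mono fun c hc _ => hc)]
  calc ∫⁻ p in breakpoint ⁻¹' A, ENNReal.ofReal (p.1 ^ 2) ∂μ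
      = ∫⁻ q in A ×ˢ univ, ENNReal.ofReal (q.2 ^ 2)
          ∂(μ.map fun p => (breakpoint p, p.1)) := by
        rw [setLIntegral_map (hA.prod .univ) hsq (by fun_prop)]
        congr 2
        ext p; simp
    _ = ∫⁻ c in A, ∫⁻ w, ENNReal.ofReal (w ^ 2) ∂κ c ∂(μ.map breakpoint) := by
        rw [← hjoint, Measure.setLIntegral_compProd hsq hA .univ]
        simp
    _ = _ := by
        rw [hmap, setLIntegral_withDensity_eq_setLIntegral_mul _ hpdf _ hA]
        · rfl
        · exact hsq.lintegral_kernel_prod_right'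

/-! ### Integrals of `[x - c]₊` against an integrable density -/

/-- For `c ≠ x` the function `y ↦ [y - c]₊` has at `x` the derivative `1` if `c < x` and `0` if
`x < c`; as it is 1-Lipschitz, the integral may be differentiated under the integral sign. -/
theorem hasDerivAt_integral_max_sub_mul {ρ : ℝ → ℝ} (hρ : Integrable ρ) {a b : ℝ}
    (hsupp : ∀ t ∉ Icc a b, ρ t = 0) (x : ℝ) :
    HasDerivAt (fun x => ∫ c, max (x - c) 0 * ρ c) (∫ c in Iic x, ρ c) x := by
  rw [← integral_indicator measurableSet_Iic]
  refine (hasDerivAt_integral_of_dominated_loc_of_lip (bound := ρ) (s := univ) univ_mem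
    (Eventually.of_forall fun y => ?_) ?_ (hρ.indicator measurableSet_Iic).aestronglyMeasurable
    (ae_of_all _ fun c => ?_) hρ ?_).2
  · exact AEStronglyMeasurable.mul (by fun_prop) hρ.1
  · refine (hρ.norm.const_mul (|x| + (|a| + |b|))).mono'
      (AEStronglyMeasurable.mul (by fun_prop) hρ.1) (ae_of_all _ fun c => ?_)
    by_cases hc : c ∈ Icc a b
    · rw [norm_mul]
      refine mul_le_mul_of_nonneg_right ?_ (norm_nonneg _)
      rw [Real.norm_eq_abs, abs_of_nonneg (le_max_right _ _)]
      refine max_le ?_ (by positivity)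
      linarith [le_abs_self x, neg_abs_le a, hc.1, abs_nonneg b]
    · simp [hsupp c hc]
  · refine LipschitzOnWith.of_dist_le_mul fun y _ z _ => ?_
    rw [Real.dist_eq, Real.dist_eq, ← sub_mul, abs_mul, mul_comm, Real.coe_nnabs]
    refine mul_le_mul_of_nonneg_left ?_ (abs_nonneg _)
    simpa using abs_max_sub_max_le_abs (y - c) (z - c) 0
  · filter_upwards [compl_mem_ae_iff.2 (measure_singleton x)] with c hc
    rcases lt_or_gt_of_ne (show c ≠ x from hc) with hlt | hgt
    · rw [indicator_of_mem (show c ∈ Iic x from hlt.le)]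
      have : HasDerivAt (fun y => (y - c) * ρ c) (ρ c) x := by
        simpa using ((hasDerivAt_id x).sub_const c).mul_const (ρ c)
      refine this.congr_of_eventuallyEq ?_
      filter_upwards [lt_mem_nhds hlt] with y hy
      rw [max_eq_left (sub_nonneg.2 hy.le)]
    · rw [indicator_of_notMem (show c ∉ Iic x from not_le.2 hgt)]
      refine (hasDerivAt_const x (0 : ℝ)).congr_of_eventuallyEq ?_
      filter_upwards [gt_mem_nhds hgt] with y hy
      rw [max_eq_right (sub_nonpos.2 hy.le), zero_mul]

theorem integral_Iic_eq_add_intervalIntegral {ρ : ℝ → ℝ} (hρ : Integrable ρ) (x : ℝ) :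
    ∫ c in Iic x, ρ c = (∫ c in Iic 0, ρ c) + ∫ c in (0)..x, ρ c := by
  rw [← intervalIntegral.integral_Iic_sub_Iic hρ.integrableOn hρ.integrableOn]
  ring

theorem continuous_integral_Iic {ρ : ℝ → ℝ} (hρ : Integrable ρ) :
    Continuous fun x => ∫ c in Iic x, ρ c := by
  rw [funext (integral_Iic_eq_add_intervalIntegral hρ)]
  exact continuous_const.add (intervalIntegral.continuous_primitive
    (fun _ _ => hρ.intervalIntegrable) 0)

theorem ae_hasDerivAt_integral_Iic {ρ : ℝ → ℝ} (hρ : Integrable ρ) :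
    ∀ᵐ x, HasDerivAt (fun x => ∫ c in Iic x, ρ c) (ρ x) x := by
  filter_upwards [LocallyIntegrable.ae_hasDerivAt_integral hρ.locallyIntegrable] with x hx
  rw [funext (integral_Iic_eq_add_intervalIntegral hρ)]
  exact (hx 0).const_add _

section DerivOn

variable {S : Set ℝ} {h : S → ℝ} {H R : ℝ → ℝ}

theorem hasDerivWithinAt_extend (hH : ∀ x : S, h x = H x) (hR : ∀ x, HasDerivAt H (R x) x)
    {x : ℝ} (hx : x ∈ S) :
    HasDerivWithinAt (Function.extend Subtype.val h 0) (R x) S x := by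
  have hext : ∀ y ∈ S, Function.extend Subtype.val h 0 y = H y := fun y hy => by
    rw [← hH ⟨y, hy⟩]
    exact Subtype.val_injective.extend_apply h 0 ⟨y, hy⟩
  exact (hR x).hasDerivWithinAt.congr hext (hext x hx)

theorem derivOn_eq_of_accPt (hH : ∀ x : S, h x = H x) (hR : ∀ x, HasDerivAt H (R x) x)
    {x : ℝ} (hx : x ∈ S) (hacc : AccPt x (𝓟 S)) : derivOn h x = R x :=
  (hasDerivWithinAt_extend hH hR hx).derivWithin hacc.uniqueDiffWithinAt

/-- At isolated points of `S` the value of `derivOn h` is the junk value `0`. When there are only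
finitely many of them, they do not accumulate, and `derivOn h` agrees with the derivative `R` of an
extension `H` of `h` near every non-isolated point. -/
theorem derivOn_eventuallyEq (hH : ∀ x : S, h x = H x) (hR : ∀ x, HasDerivAt H (R x) x)
    (hfin : {x ∈ S | ¬AccPt x (𝓟 S)}.Finite) {x : ℝ} (hacc : AccPt x (𝓟 S)) :
    derivOn h =ᶠ[𝓝[S] x] R := by
  have hmem : {x ∈ S | ¬AccPt x (𝓟 S)}ᶜ ∈ 𝓝 x :=
    hfin.isClosed.isOpen_compl.mem_nhds fun h' => h'.2 hacc
  filter_upwards [self_mem_nhdsWithin, mem_nhdsWithin_of_mem_nhds hmem] with y hy hy'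
  exact derivOn_eq_of_accPt hH hR hy (by_contra fun hn => hy' ⟨hy, hn⟩)

/-- A function `h` on `S` of the form `x ↦ ∫ [x - c]₊ ρ(c) dc + u x + v`, with `ρ` integrable and
zero off `S`, has the second derivative `ρ` on `S`: the formula for `h` extends it to a `C¹`
function on `ℝ` with derivative `x ↦ ∫_{c ≤ x} ρ(c) dc + u`, and Lebesgue's differentiation
theorem applies to the latter. -/
theorem hasIntegrableSecondDerivOn_of_integral_max_sub_mul {ρ : ℝ → ℝ} (hρ : Integrable ρ)
    {a b : ℝ} (hS : S ⊆ Icc a b) (hSm : MeasurableSet S) (hsupp : ∀ t ∉ S, ρ t = 0)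
    (hfin : {x ∈ S | ¬AccPt x (𝓟 S)}.Finite) {u v : ℝ}
    (hh : ∀ x : S, h x = (∫ c, max ((x : ℝ) - c) 0 * ρ c) + (u * x + v)) :
    HasIntegrableSecondDerivOn h ∧ secondDerivOn h =ᵐ[volume.restrict S] ρ := by
  set H : ℝ → ℝ := fun x => (∫ c, max (x - c) 0 * ρ c) + (u * x + v) with hHdef
  set R : ℝ → ℝ := fun x => (∫ c in Iic x, ρ c) + u with hRdef
  have hR : ∀ x, HasDerivAt H (R x) x := fun x => by
    refine (hasDerivAt_integral_max_sub_mul hρ (fun t ht => hsupp t fun h' => ht (hS h')) x).add ?_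
    simpa using ((hasDerivAt_id x).const_mul u).add_const v
  have hRcont : Continuous R := (continuous_integral_Iic hρ).add continuous_const
  have hRderiv : ∀ᵐ x, HasDerivAt R (ρ x) x :=
    (ae_hasDerivAt_integral_Iic hρ).mono fun x hx => hx.add_const u
  have haccae : ∀ᵐ x ∂volume.restrict S, AccPt x (𝓟 S) := by
    rw [ae_restrict_iff' hSm]
    filter_upwards [compl_mem_ae_iff.2 (hfin.measure_zero volume)] with x hx hxS
    exact by_contra fun hn => hx ⟨hxS, hn⟩
  have hderiv : ∀ᵐ x ∂volume.restrict S, HasDerivWithinAt (derivOn h) (ρ x) S x := by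
    filter_upwards [haccae, ae_restrict_mem hSm, ae_restrict_of_ae hRderiv] with x hx hxS hxR
    exact hxR.hasDerivWithinAt.congr_of_eventuallyEq
      (derivOn_eventuallyEq hh hR hfin hx) (derivOn_eq_of_accPt hh hR hxS hx)
  have hsecond : secondDerivOn h =ᵐ[volume.restrict S] ρ := by
    filter_upwards [haccae, hderiv] with x hx hxd
    exact hxd.derivWithin hx.uniqueDiffWithinAt
  refine ⟨⟨fun x hx => (hasDerivWithinAt_extend hh hR hx).differentiableWithinAt, fun x hx => ?_,
    hderiv.mono fun x hx => hx.differentiableWithinAt, ?_, ?_⟩, hsecond⟩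
  · by_cases hacc : AccPt x (𝓟 S)
    · exact hRcont.continuousWithinAt.congr_of_eventuallyEq
        (derivOn_eventuallyEq hh hR hfin hacc) (derivOn_eq_of_accPt hh hR hx hacc)
    · exact (HasFDerivWithinAt.of_not_accPt (𝕜 := ℝ) (f' := 0) hacc).continuousWithinAt
  · exact hρ.integrableOn.congr_fun_ae hsecond.symm
  · intro p hp q hq hpa hqa hpq
    rw [derivOn_eq_of_accPt hh hR hp hpa, derivOn_eq_of_accPt hh hR hq hqa, hRdef,
      add_sub_add_right_eq_sub,
      intervalIntegral.integral_Iic_sub_Iic hρ.integrableOn hρ.integrableOn,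
      intervalIntegral.integral_of_le hpq, ← integral_Icc_eq_integral_Ioc]
    have h1 : ∫ x in S ∩ Icc p q, secondDerivOn h x = ∫ x in S ∩ Icc p q, ρ x :=
      integral_congr_ae (ae_restrict_of_ae_restrict_of_subset inter_subset_left hsecond)
    rw [h1, inter_comm]
    refine setIntegral_eq_of_subset_of_forall_sdiff_eq_zero measurableSet_Icc inter_subset_left ?_
    exact fun t ht => hsupp t fun h' => ht.2 ⟨ht.1, h'⟩

end DerivOn

/-- A point of the support of an atomless measure in the open interval `(a, b)` is not isolated in
`support ∩ [a, b]`; hence only `a` and `b` can be isolated in this set. -/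
theorem finite_not_accPt_support_inter_Icc (ν : Measure ℝ) [NullSingletonClass ν] (a b : ℝ) :
    {x ∈ ν.support ∩ Icc a b | ¬AccPt x (𝓟 (ν.support ∩ Icc a b))}.Finite := by
  refine (Set.toFinite {a, b}).subset ?_
  rintro x ⟨⟨hxs, hxI⟩, hacc⟩
  by_contra hne
  simp only [mem_insert_iff, mem_singleton_iff, not_or] at hne
  have hIoo : Ioo a b ∈ 𝓝 x :=
    Ioo_mem_nhds (lt_of_le_of_ne hxI.1 (Ne.symm hne.1)) (lt_of_le_of_ne hxI.2 hne.2)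
  rw [accPt_iff_nhds] at hacc
  push Not at hacc
  obtain ⟨U, hU, hUx⟩ := hacc
  have hpos := (Measure.mem_support_iff_forall x).1 hxs (U ∩ Ioo a b) (inter_mem hU hIoo)
  refine hpos.ne' (measure_mono_null (t := {x} ∪ ν.supportᶜ) ?_ ?_)
  · rintro y ⟨hyU, hyI⟩
    by_cases hy : y ∈ ν.support
    · exact Or.inl (hUx y ⟨hyU, hy, Ioo_subset_Icc_self hyI⟩)
    · exact Or.inr hy
  · exact measure_union_null (measure_singleton x) Measure.measure_compl_support

/-! ### Weighted composition as an isometry of `L²` spaces -/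

section WeightedComposition

variable {Ω : Type*} [MeasurableSpace Ω] {μ : Measure Ω} {ν : Measure ℝ} {w C : Ω → ℝ} {I : Set ℝ}

/-- A property that holds almost everywhere on `I` for the image `ν` of `w² μ` under `C` holds at
`C p` for almost every `p` with `w p ≠ 0` and `C p ∈ I`. -/
theorem ae_comp_of_ae_map_withDensity (hw : Measurable w) (hC : Measurable C)
    (hI : MeasurableSet I)
    (hν : (μ.withDensity fun p => ENNReal.ofReal (w p ^ 2)).map C = ν) {P : ℝ → Prop}
    (hP : ∀ᵐ t ∂ν.restrict I, P t) :
    ∀ᵐ p ∂μ, w p ≠ 0 → C p ∈ I → P (C p) := by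
  rw [ae_restrict_iff' hI, ← hν] at hP
  have h1 := ae_of_ae_map hC.aemeasurable hP
  rw [ae_withDensity_iff (by fun_prop)] at h1
  filter_upwards [h1] with p hp hwp
  exact hp (by simpa using hwp)

theorem eLpNorm_indicator_mul_comp (hw : Measurable w) (hC : Measurable C) (hI : MeasurableSet I)
    (hν : (μ.withDensity fun p => ENNReal.ofReal (w p ^ 2)).map C = ν)
    {f : ℝ → ℝ} (hf : Measurable f) :
    eLpNorm ((C ⁻¹' I).indicator fun p => w p * f (C p)) 2 μ =
      eLpNorm f 2 (ν.restrict I) := by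
  rw [← hν, eLpNorm_indicator_eq_eLpNorm_restrict (hC hI),
    eLpNorm_eq_lintegral_rpow_enorm_toReal two_ne_zero ENNReal.ofNat_ne_top,
    eLpNorm_eq_lintegral_rpow_enorm_toReal two_ne_zero ENNReal.ofNat_ne_top,
    setLIntegral_map hI (by fun_prop) hC,
    setLIntegral_withDensity_eq_setLIntegral_mul _ (by fun_prop) (by fun_prop) (hC hI)]
  congr 2
  ext p
  simp only [ENNReal.toReal_ofNat, ENNReal.rpow_ofNat, enorm_mul, mul_pow, Pi.mul_apply]
  congr 1
  rw [← enorm_pow, Real.enorm_of_nonneg (sq_nonneg _)]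

/-- If `ν` is the image of `w² μ` under `C`, then `f ↦ 1_I(C) w f(C)` is an isometry from `L²(ν|_I)`
to `L²(μ)`. -/
theorem exists_isometry_mul_comp (hw : Measurable w) (hC : Measurable C) (hI : MeasurableSet I)
    (hν : (μ.withDensity fun p => ENNReal.ofReal (w p ^ 2)).map C = ν) :
    ∃ J : Lp ℝ 2 (ν.restrict I) →ₗᵢ[ℝ] Lp ℝ 2 μ,
      ∀ f, J f =ᵐ[μ] (C ⁻¹' I).indicator fun p => w p * f (C p) := by
  have hmem : ∀ f : Lp ℝ 2 (ν.restrict I),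
      MemLp ((C ⁻¹' I).indicator fun p => w p * f (C p)) 2 μ := by
    intro f
    have hf : Measurable f := (Lp.stronglyMeasurable f).measurable
    refine ⟨((hw.mul (hf.comp hC)).indicator (hC hI)).aestronglyMeasurable, ?_⟩
    rw [eLpNorm_indicator_mul_comp hw hC hI hν hf]
    exact Lp.eLpNorm_lt_top f
  let T : Lp ℝ 2 (ν.restrict I) →ₗ[ℝ] Lp ℝ 2 μ :=
    { toFun := fun f => (hmem f).toLp
      map_add' := fun f g => by
        rw [← MemLp.toLp_add]
        refine MemLp.toLp_congr _ _ ?_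
        filter_upwards [ae_comp_of_ae_map_withDensity hw hC hI hν (Lp.coeFn_add f g)] with p hp
        by_cases hpI : p ∈ C ⁻¹' I
        · by_cases hwp : w p = 0
          · simp [hpI, hwp]
          · simp only [Pi.add_apply, indicator_of_mem hpI, hp hwp hpI, mul_add]
        · simp [hpI]
      map_smul' := fun c f => by
        rw [RingHom.id_apply, ← MemLp.toLp_const_smul]
        refine MemLp.toLp_congr _ _ ?_
        filter_upwards [ae_comp_of_ae_map_withDensity hw hC hI hν (Lp.coeFn_smul c f)] with p hp
        by_cases hpI : p ∈ C ⁻¹' I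
        · by_cases hwp : w p = 0
          · simp [hpI, hwp]
          · simp only [Pi.smul_apply, smul_eq_mul, indicator_of_mem hpI, hp hwp hpI,
              mul_left_comm]
        · simp [hpI] }
  refine ⟨⟨T, fun f => ?_⟩, fun f => (hmem f).coeFn_toLp⟩
  change ‖(hmem f).toLp‖ = ‖f‖
  rw [Lp.norm_toLp, eLpNorm_indicator_mul_comp hw hC hI hν (Lp.stronglyMeasurable f).measurable,
    Lp.norm_def]

end WeightedComposition

/-! ### Splitting the ReLU features -/

theorem memLp_max_sub {ν : Measure ℝ} [IsFiniteMeasure ν] (a b x : ℝ) :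
    MemLp (fun c : ℝ => max (x - c) 0) 2 (ν.restrict (Icc a b)) := by
  refine MemLp.of_bound (C := |x| + |a|) (by fun_prop) ?_
  filter_upwards [ae_restrict_mem measurableSet_Icc] with c hc
  rw [Real.norm_eq_abs, abs_of_nonneg (le_max_right _ _)]
  refine max_le ?_ (by positivity)
  linarith [le_abs_self x, neg_abs_le a, hc.1]

/-- For `x ∈ [a, b]`, a ReLU unit with breakpoint in `[a, b]` and positive weight is `|W| [x - C]₊`,
one with negative weight is `|W| [x - C]₊ + (W x + b)`, and one with breakpoint outside `[a, b]`
equals `W x + b` or `0` on all of `[a, b]`. -/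
theorem reluUnit_eq_add {p : ℝ × ℝ} (hp : p.1 ≠ 0) {a b x : ℝ} (hx : x ∈ Icc a b) :
    reluUnit x p =
      (breakpoint ⁻¹' Icc a b).indicator (fun p => |p.1| * max (x - breakpoint p) 0) p +
      (x * {p : ℝ × ℝ | 0 < p.1 ∧ breakpoint p < a ∨ p.1 < 0 ∧ a ≤ breakpoint p}.indicator
          Prod.fst p +
        {p : ℝ × ℝ | 0 < p.1 ∧ breakpoint p < a ∨ p.1 < 0 ∧ a ≤ breakpoint p}.indicator
          Prod.snd p) := by
  obtain ⟨W, B⟩ := p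
  change W ≠ 0 at hp
  set c := breakpoint (W, B) with hc
  have hB : B = -(W * c) := by
    rw [hc, breakpoint]; field_simp
  have hr : reluUnit x (W, B) = max (W * (x - c)) 0 := by
    rw [reluUnit, hB]; congr 1; ring
  obtain ⟨hxa, hxb⟩ := hx
  rw [hr]
  simp only [indicator, mem_preimage, ← hc, mem_Icc, mem_ofPred_eq]
  rcases lt_or_gt_of_ne hp with hneg | hpos
  · rw [abs_of_neg hneg]
    by_cases hac : a ≤ c
    · by_cases hcx : c ≤ x
      · rw [max_eq_right (mul_nonpos_of_nonpos_of_nonneg hneg.le (sub_nonneg.2 hcx)),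
          max_eq_left (sub_nonneg.2 hcx), if_pos ⟨hac, hcx.trans hxb⟩, if_pos (Or.inr ⟨hneg, hac⟩),
          if_pos (Or.inr ⟨hneg, hac⟩), hB]
        ring
      · have hxc : x ≤ c := (not_le.1 hcx).le
        rw [max_eq_left (mul_nonneg_of_nonpos_of_nonpos hneg.le (sub_nonpos.2 hxc)),
          max_eq_right (sub_nonpos.2 hxc), if_pos (Or.inr ⟨hneg, hac⟩),
          if_pos (Or.inr ⟨hneg, hac⟩), hB]
        simp only [mul_zero, ite_self]
        ring
    · have hcx : c ≤ x := (not_le.1 hac).le.trans hxa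
      rw [max_eq_right (mul_nonpos_of_nonpos_of_nonneg hneg.le (sub_nonneg.2 hcx))]
      simp [hac, hneg.not_gt]
  · rw [abs_of_pos hpos]
    by_cases hac : a ≤ c
    · by_cases hcb : c ≤ b
      · simp [hac, hcb, hpos.not_gt, hac.not_gt, mul_max_of_nonneg _ _ hpos.le]
      · have hxc : x ≤ c := hxb.trans (not_le.1 hcb).le
        rw [max_eq_right (mul_nonpos_of_nonneg_of_nonpos hpos.le (sub_nonpos.2 hxc))]
        simp [hcb, hpos.not_gt, hac.not_gt]
    · have hcx : c ≤ x := (not_le.1 hac).le.trans hxa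
      rw [max_eq_left (mul_nonneg hpos.le (sub_nonneg.2 hcx)),
        if_pos (Or.inl ⟨hpos, not_le.1 hac⟩), if_pos (Or.inl ⟨hpos, not_le.1 hac⟩),
        if_neg fun h' => hac h'.1, hB]
      ring

theorem isFiniteMeasure_withDensity_zeta (μ : Measure (ℝ × ℝ)) [IsFiniteMeasure μ]
    (hμ : MemLp (fun p : ℝ × ℝ => p) 2 μ) (hC : HasPDF breakpoint μ volume) :
    IsFiniteMeasure (volume.withDensity fun t => ENNReal.ofReal (zeta μ t)) := by
  rw [← map_breakpoint_withDensity μ hμ hC]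
  have := isFiniteMeasure_withDensity_ofReal (integrable_fst_sq hμ).2
  infer_instance

/-- In `L²(μ)`, the feature `[W x + b]₊` for `x ∈ [a, b]` is the image of `c ↦ [x - c]₊` under an
isometry from `L²(ζ(t) dt)` on `[a, b]`, plus a term which is affine in `x`. -/
theorem exists_toLp_reluUnit_eq (μ : Measure (ℝ × ℝ)) [IsFiniteMeasure μ]
    (hμ : MemLp (fun p : ℝ × ℝ => p) 2 μ) (hW : μ {p | p.1 = 0} = 0)
    (hC : HasPDF breakpoint μ volume)
    [IsFiniteMeasure (volume.withDensity fun t => ENNReal.ofReal (zeta μ t))] (a b : ℝ) :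
    ∃ (J : Lp ℝ 2 ((volume.withDensity fun t => ENNReal.ofReal (zeta μ t)).restrict (Icc a b))
        →ₗᵢ[ℝ] Lp ℝ 2 μ) (Q₁ Q₀ : Lp ℝ 2 μ), ∀ x ∈ Icc a b,
      (memLp_reluUnit μ hμ x).toLp = J (memLp_max_sub a b x).toLp + (x • Q₁ + Q₀) := by
  have hbm := measurable_breakpoint
  have hw : Measurable fun p : ℝ × ℝ => |p.1| := by fun_prop
  have hmap : (μ.withDensity fun p => ENNReal.ofReal (|p.1| ^ 2)).map breakpoint =
      volume.withDensity fun t => ENNReal.ofReal (zeta μ t) := by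
    simpa only [sq_abs] using map_breakpoint_withDensity μ hμ hC
  obtain ⟨J, hJ⟩ := exists_isometry_mul_comp hw hbm (measurableSet_Icc (a := a) (b := b)) hmap
  set E : Set (ℝ × ℝ) := {p | 0 < p.1 ∧ breakpoint p < a ∨ p.1 < 0 ∧ a ≤ breakpoint p} with hE
  have hEm : MeasurableSet E :=
    ((measurableSet_lt measurable_const measurable_fst).inter
      (measurableSet_lt hbm measurable_const)).union
    ((measurableSet_lt measurable_fst measurable_const).inter
      (measurableSet_le measurable_const hbm))
  have h₁ : MemLp (E.indicator Prod.fst) 2 μ := hμ.fst.indicator hEm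
  have h₀ : MemLp (E.indicator Prod.snd) 2 μ := hμ.snd.indicator hEm
  refine ⟨J, h₁.toLp, h₀.toLp, fun x hx => Lp.ext ?_⟩
  have hWae : ∀ᵐ p ∂μ, p.1 ≠ 0 := by rw [ae_iff]; simpa using hW
  filter_upwards [hWae, (memLp_reluUnit μ hμ x).coeFn_toLp, h₁.coeFn_toLp, h₀.coeFn_toLp,
    hJ (memLp_max_sub a b x).toLp, Lp.coeFn_smul x h₁.toLp, Lp.coeFn_add (x • h₁.toLp) h₀.toLp,
    Lp.coeFn_add (J (memLp_max_sub a b x).toLp) (x • h₁.toLp + h₀.toLp),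
    ae_comp_of_ae_map_withDensity hw hbm measurableSet_Icc hmap
      (memLp_max_sub (ν := volume.withDensity fun t => ENNReal.ofReal (zeta μ t))
        a b x).coeFn_toLp] with p hp e1 e2 e3 e4 e5 e6 e7 e8
  rw [e1, e7, Pi.add_apply, e6, Pi.add_apply, e5, Pi.smul_apply, e2, e3, e4, smul_eq_mul,
    reluUnit_eq_add hp hx]
  congr 1
  by_cases hpI : p ∈ breakpoint ⁻¹' Icc a b
  · rw [indicator_of_mem hpI, indicator_of_mem hpI, e8 (abs_ne_zero.2 hp) hpI]
  · rw [indicator_of_notMem hpI, indicator_of_notMem hpI]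

/-! ### Embedding the kernel space into `L²(μ)` -/

theorem exists_isometry_kernelSpace (μ : Measure (ℝ × ℝ)) [IsFiniteMeasure μ]
    [hμ : Fact (MemLp (fun p : ℝ × ℝ => p) 2 μ)] (S : Set ℝ) :
    ∃ U : KernelSpace μ S →ₗᵢ[ℝ] Lp ℝ 2 μ, ∀ x : S,
      U (RKHS.kerFun (KernelSpace μ S) x 1) = (memLp_reluUnit μ hμ.out x).toLp := by
  refine exists_isometry_of_kernel_eq_inner
    (fun x : S => (memLp_reluUnit μ hμ.out x).toLp) fun x y => ?_
  rw [kernel_kernelSpace, L2.inner_def, outputNTK]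
  simp only [_root_.smul_apply, ContinuousLinearMap.id_apply, smul_eq_mul, mul_one]
  refine integral_congr_ae ?_
  filter_upwards [(memLp_reluUnit μ hμ.out x).coeFn_toLp,
    (memLp_reluUnit μ hμ.out y).coeFn_toLp] with p hx hy
  rw [hx, hy]
  simp [mul_comm]

/-- If the kernel functions correspond to `J (φ x)` plus a term affine in `x`, then the elements of
`spaceW` correspond to vectors in the range of `J`. -/
theorem map_mem_range_of_mem_spaceW {μ : Measure (ℝ × ℝ)} [IsFiniteMeasure μ]
    [Fact (MemLp (fun p : ℝ × ℝ => p) 2 μ)] {S : Set ℝ} {F : Type*} [NormedAddCommGroup F]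
    [InnerProductSpace ℝ F] [CompleteSpace F] {U : KernelSpace μ S →ₗᵢ[ℝ] Lp ℝ 2 μ}
    {φ : ℝ → F} {J : F →ₗᵢ[ℝ] Lp ℝ 2 μ} {Q₁ Q₀ : Lp ℝ 2 μ}
    (hU : ∀ x : S, U (RKHS.kerFun (KernelSpace μ S) x 1) = J (φ x) + ((x : ℝ) • Q₁ + Q₀))
    {h : KernelSpace μ S} (hh : h ∈ spaceW μ S) : ∃ f, J f = U h := by
  set V : Submodule ℝ (Lp ℝ 2 μ) := LinearMap.range J.toLinearMap with hV
  have : CompleteSpace V := by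
    have hc : IsComplete (range J) := J.isometry.isUniformInducing.isComplete_range
    exact hc.completeSpace_coe
  suffices h' : U h ∈ V from h'
  rw [← V.orthogonal_orthogonal, Submodule.mem_orthogonal]
  intro g hg
  have hgJ : ∀ f, ⟪g, J f⟫_ℝ = 0 := fun f => (V.mem_orthogonal' g).1 hg _ ⟨f, rfl⟩
  have hadj : ∀ k, ⟪U.toContinuousLinearMap.adjoint g, k⟫_ℝ = ⟪g, U k⟫_ℝ := fun k =>
    ContinuousLinearMap.adjoint_inner_left _ _ _
  rw [← hadj]
  -- The element of the kernel space represented by `g` is an affine function, as `g ⟂ V`.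
  refine (Submodule.mem_orthogonal _ _).1 hh _ ⟨⟪g, Q₁⟫_ℝ, ⟪g, Q₀⟫_ℝ, fun x => ?_⟩
  have h1 := hadj (RKHS.kerFun (KernelSpace μ S) x 1)
  rw [RKHS.inner_kerFun, hU, inner_add_right, hgJ, inner_add_right, inner_smul_right, zero_add]
    at h1
  rw [mul_comm, ← h1]
  simp

/-! ### Integrals with respect to `ζ(t) dt` -/

section WithDensity

variable {z : ℝ → ℝ} {a b : ℝ} {S : Set ℝ}

/-- The complement of the support of `z(t) dt` is a null set of this measure, so it does not matter
whether the measure is restricted to `[a, b]` or to the part of its support in `[a, b]`. -/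
theorem restrict_withDensity_Icc_eq :
    (volume.withDensity fun t => ENNReal.ofReal (z t)).restrict (Icc a b) =
      (volume.restrict ((volume.withDensity fun t => ENNReal.ofReal (z t)).support ∩
        Icc a b)).withDensity fun t => ENNReal.ofReal (z t) := by
  set ν := volume.withDensity fun t => ENNReal.ofReal (z t) with hν
  have hm : MeasurableSet (ν.support ∩ Icc a b) :=
    Measure.isClosed_support.measurableSet.inter measurableSet_Icc
  rw [← restrict_withDensity hm, ← hν]
  refine Measure.restrict_congr_set ?_
  filter_upwards [Measure.support_mem_ae (μ := ν)] with t ht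
  exact propext ⟨fun h => ⟨ht, h⟩, fun h => h.2⟩

theorem integrable_restrict_withDensity_iff (hz : Measurable z) (hz0 : ∀ t, 0 ≤ z t)
    (hS : S = (volume.withDensity fun t => ENNReal.ofReal (z t)).support ∩ Icc a b)
    {g : ℝ → ℝ} :
    Integrable g ((volume.withDensity fun t => ENNReal.ofReal (z t)).restrict (Icc a b)) ↔
      IntegrableOn (fun t => z t * g t) S := by
  rw [restrict_withDensity_Icc_eq, ← hS, integrable_withDensity_iff_integrable_smul'
    (by fun_prop) (ae_of_all _ fun t => ENNReal.ofReal_lt_top), IntegrableOn]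
  simp only [ENNReal.toReal_ofReal (hz0 _), smul_eq_mul]

theorem integral_restrict_withDensity (hz : Measurable z) (hz0 : ∀ t, 0 ≤ z t)
    (hS : S = (volume.withDensity fun t => ENNReal.ofReal (z t)).support ∩ Icc a b)
    (g : ℝ → ℝ) :
    ∫ t, g t ∂((volume.withDensity fun t => ENNReal.ofReal (z t)).restrict (Icc a b)) =
      ∫ t in S, z t * g t := by
  rw [restrict_withDensity_Icc_eq, ← hS, integral_withDensity_eq_integral_toReal_smul
    (by fun_prop) (ae_of_all _ fun t => ENNReal.ofReal_lt_top)]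
  simp only [ENNReal.toReal_ofReal (hz0 _), smul_eq_mul]

end WithDensity

/-! ### The norm formula -/

/-- The norm formula on the part of the support of `ζ(t) dt` in an arbitrary compact interval. -/
theorem norm_sq_eq_integral_secondDerivOn_sq_div_zeta (μ : Measure (ℝ × ℝ)) [IsFiniteMeasure μ]
    [Fact (MemLp (fun p : ℝ × ℝ => p) 2 μ)] (hW : μ {p | p.1 = 0} = 0)
    (hC : HasPDF breakpoint μ volume) {a b : ℝ} {S : Set ℝ}
    (hS : S = (volume.withDensity fun t => ENNReal.ofReal (zeta μ t)).support ∩ Icc a b)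
    {h : KernelSpace μ S} (hh : h ∈ spaceW μ S) :
    HasIntegrableSecondDerivOn (h : S → ℝ) ∧
    IntegrableOn (fun t => secondDerivOn (h : S → ℝ) t ^ 2 / zeta μ t) S ∧
    ‖h‖ ^ 2 = ∫ t in S, secondDerivOn (h : S → ℝ) t ^ 2 / zeta μ t := by
  have hμ : MemLp (fun p : ℝ × ℝ => p) 2 μ := Fact.out
  have hz := measurable_zeta μ
  have hz0 := zeta_nonneg μ
  have hfinite := isFiniteMeasure_withDensity_zeta μ hμ hC
  have hSm : MeasurableSet S := by
    rw [hS]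
    exact Measure.isClosed_support.measurableSet.inter measurableSet_Icc
  have hSI : S ⊆ Icc a b := hS ▸ inter_subset_right
  obtain ⟨U, hU⟩ := exists_isometry_kernelSpace μ S
  obtain ⟨J, Q₁, Q₀, hJ⟩ := exists_toLp_reluUnit_eq μ hμ hW hC a b
  have hUJ : ∀ y : S, U (RKHS.kerFun (KernelSpace μ S) y 1) =
      J (memLp_max_sub a b y).toLp + ((y : ℝ) • Q₁ + Q₀) := fun y => by
    rw [hU, hJ y (hSI y.2)]
  obtain ⟨f, hf⟩ := map_mem_range_of_mem_spaceW
    (φ := fun y : ℝ => (memLp_max_sub a b y).toLp) hUJ hh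
  have hfL2 := Lp.memLp f
  have hzf : IntegrableOn (fun t => zeta μ t * f t) S :=
    (integrable_restrict_withDensity_iff hz hz0 hS).1 (hfL2.integrable one_le_two)
  have hzf2 : IntegrableOn (fun t => zeta μ t * f t ^ 2) S :=
    (integrable_restrict_withDensity_iff hz hz0 hS).1 hfL2.integrable_sq
  set ρ : ℝ → ℝ := S.indicator fun t => zeta μ t * f t with hρdef
  have hrep : ∀ y : S, h y = (∫ c, max ((y : ℝ) - c) 0 * ρ c) +
      (⟪U h, Q₁⟫_ℝ * y + ⟪U h, Q₀⟫_ℝ) := fun y => by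
    have h1 : h y = ⟪U h, U (RKHS.kerFun (KernelSpace μ S) y 1)⟫_ℝ := by
      rw [U.inner_map_map, RKHS.inner_kerFun]
      simp
    have h2 : ⟪f, (memLp_max_sub a b (y : ℝ)).toLp⟫_ℝ = ∫ c, max ((y : ℝ) - c) 0 * ρ c := by
      have h3 : ∀ c, max ((y : ℝ) - c) 0 * ρ c =
          S.indicator (fun t => zeta μ t * (max ((y : ℝ) - t) 0 * f t)) c := fun c => by
        by_cases hc : c ∈ S
        · simp only [hρdef, indicator_of_mem hc]; ring
        · simp only [hρdef, indicator_of_notMem hc, mul_zero]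
      simp only [h3]
      rw [integral_indicator hSm, ← integral_restrict_withDensity hz hz0 hS, L2.inner_def]
      refine integral_congr_ae ?_
      filter_upwards [(memLp_max_sub
        (ν := volume.withDensity fun t => ENNReal.ofReal (zeta μ t)) a b y).coeFn_toLp] with t ht
      rw [ht]
      simp
    rw [h1, hUJ, inner_add_right, ← hf, J.inner_map_map, h2, inner_add_right, inner_smul_right,
      mul_comm (y : ℝ)]
  have hfin : {x ∈ S | ¬AccPt x (𝓟 S)}.Finite := by
    rw [hS]
    exact finite_not_accPt_support_inter_Icc _ a b
  obtain ⟨hderiv, hsecond⟩ := hasIntegrableSecondDerivOn_of_integral_max_sub_mul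
    (hzf.integrable_indicator hSm) hSI hSm (fun t ht => indicator_of_notMem ht _)
    hfin hrep
  have hquot : (fun t => secondDerivOn (h : S → ℝ) t ^ 2 / zeta μ t) =ᵐ[volume.restrict S]
      fun t => zeta μ t * f t ^ 2 := by
    filter_upwards [hsecond, ae_restrict_mem hSm] with t ht htS
    rw [ht, indicator_of_mem htS]
    -- Where `ζ = 0`, both sides vanish, by `0 / 0 = 0` on the left.
    by_cases h0 : zeta μ t = 0
    · simp [h0]
    · field_simp
  refine ⟨hderiv, hzf2.congr_fun_ae hquot.symm, ?_⟩
  rw [integral_congr_ae hquot, ← integral_restrict_withDensity hz hz0 hS, ← U.norm_map, ← hf,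
    J.norm_map, ← real_inner_self_eq_norm_sq, L2.inner_def]
  simp [sq]

theorem mainTheorem10 (μ : Measure (ℝ × ℝ)) [IsProbabilityMeasure μ]
    [Fact (MemLp (fun p : ℝ × ℝ => p) 2 μ)]
    (hW : μ {p | p.1 = 0} = 0)
    (hC : HasPDF breakpoint μ volume)
    (M : ℕ) (hM : 0 < M) (x : Fin M → ℝ)
    (h : KernelSpace μ (inputDomain μ x)) (hh : h ∈ spaceW μ (inputDomain μ x)) :
    HasIntegrableSecondDerivOn (h : inputDomain μ x → ℝ) ∧
    IntegrableOn (fun t => secondDerivOn (h : inputDomain μ x → ℝ) t ^ 2 / zeta μ t)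
      (inputDomain μ x) ∧
    ‖h‖ ^ 2 = ∫ t in inputDomain μ x,
      secondDerivOn (h : inputDomain μ x → ℝ) t ^ 2 / zeta μ t :=
  norm_sq_eq_integral_secondDerivOn_sq_div_zeta μ hW hC rfl hh
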